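/- Let $F$ be an algebraically closed field of characteristic zero and let $R$ be a simple associative $F$-algebra (not necessarily unital) that has a minimal left or a minimal right ideal $I$ whose $R$-module endomorphisms are only the scalar multiplications by elements of $F$. (For simple $R$ this says that $R\cong V\otimes_F\Pi$ for a nonzero $F$-vector space $V$ and a subspace $\Pi\subseteq V^*$ with $\bigcap_{\pi\in\Pi}\ker\pi=0$, with the product $(v_1\otimes\pi_1)(v_2\otimes\pi_2)=\pi_1(v_2)\,v_1\otimes\pi_2$.) Let $G$ be a finite abelian group and let $R=\bigoplus_{g\in G}R^{(g)}$ be a grading by $G$, that is, a decomposition into a direct sum of subspaces with $R^{(g)}R^{(h)}\subseteq R^{(gh)}$ for all $g,h\in G$. Then $R$ has a local system of graded finite-dimensional matrix subalgebras: there is a family $\mathcal S$ of subalgebras of $R$, directed by inclusion and with union $R$, such that every $A\in\mathcal S$ is isomorphic as an $F$-algebra to a matrix algebra $M_n(F)$ with $n\ge 1$ (depending on $A$) and satisfies $A=\bigoplus_{g\in G}(A\cap R^{(g)})$. -/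

import Mathlib

/-!
Graded simple algebras with minimal one-sided ideals. Algebras are associative and need not have
an identity; ideals of an `F`-algebra are `F`-subspaces.
-/

namespace GradedSimple

section Ideals

variable {F R : Type*} [Field F] [NonUnitalRing R] [Module F R]

/-- The subspace `L` is a left ideal of the algebra `R`. -/
def IsLeftIdeal (L : Submodule F R) : Prop :=
  ∀ r : R, ∀ x ∈ L, r * x ∈ L

/-- The subspace `L` is a right ideal of the algebra `R`. -/
def IsRightIdeal (L : Submodule F R) : Prop :=
  ∀ r : R, ∀ x ∈ L, x * r ∈ L

/-- `L` is minimal among the nonzero left ideals. -/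
def IsMinimalLeftIdeal (L : Submodule F R) : Prop :=
  Minimal (fun J : Submodule F R => J ≠ ⊥ ∧ IsLeftIdeal J) L

/-- `L` is minimal among the nonzero right ideals. -/
def IsMinimalRightIdeal (L : Submodule F R) : Prop :=
  Minimal (fun J : Submodule F R => J ≠ ⊥ ∧ IsRightIdeal J) L

/-- Every endomorphism of the left ideal `L`, as a left `R`-module, is a scalar from `F`. -/
def LeftEndIsScalar (L : Submodule F R) : Prop :=
  ∀ f : L →ₗ[F] L, (∀ (r : R) (x y : L), (y : R) = r * (x : R) → (f y : R) = r * (f x : R)) →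
    ∃ c : F, ∀ x : L, f x = c • x

/-- Every endomorphism of the right ideal `L`, as a right `R`-module, is a scalar from `F`. -/
def RightEndIsScalar (L : Submodule F R) : Prop :=
  ∀ f : L →ₗ[F] L, (∀ (r : R) (x y : L), (y : R) = (x : R) * r → (f y : R) = (f x : R) * r) →
    ∃ c : F, ∀ x : L, f x = c • x

variable (F R) in
/-- `R` has a minimal one-sided ideal whose endomorphism division algebra is the ground field. -/
def HasMinimalOneSidedIdealOverGroundField : Prop :=
  (∃ L : Submodule F R, IsMinimalLeftIdeal L ∧ LeftEndIsScalar L) ∨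
  (∃ L : Submodule F R, IsMinimalRightIdeal L ∧ RightEndIsScalar L)

end Ideals

section Gradings

variable {F R G : Type*} [Field F] [NonUnitalRing R] [Module F R]

/-- The subspaces `𝓡 g` form a grading of the algebra `R` by the group `G`. -/
structure IsGrading [Group G] [DecidableEq G] (𝓡 : G → Submodule F R) : Prop where
  isInternal : DirectSum.IsInternal 𝓡
  mul_mem : ∀ g h : G, ∀ a ∈ 𝓡 g, ∀ b ∈ 𝓡 h, a * b ∈ 𝓡 (g * h)

/-- The subspace `V` is graded: it is the sum of the intersections `V ∩ 𝓡 g` (the sum is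
automatically direct when `𝓡` is a grading). -/
def IsGradedSubspace (𝓡 : G → Submodule F R) (V : Submodule F R) : Prop :=
  V = ⨆ g, V ⊓ 𝓡 g

/-- The subalgebra `A` is isomorphic to the algebra of `n × n` matrices over `F`, some `n ≥ 1`. -/
def IsMatrixSubalgebra (A : NonUnitalSubalgebra F R) : Prop :=
  ∃ n : ℕ, 1 ≤ n ∧ ∃ φ : A →ₙₐ[F] Matrix (Fin n) (Fin n) F, Function.Bijective φ

/-- A local system of subalgebras of `R`: a family directed by inclusion whose union is `R`. -/
structure IsLocalSystem (𝓢 : Set (NonUnitalSubalgebra F R)) : Prop where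
  directed : DirectedOn (· ≤ ·) 𝓢
  exists_mem : ∀ x : R, ∃ A ∈ 𝓢, x ∈ A

end Gradings

end GradedSimple

/-! The minimal one-sided ideal yields an idempotent `e` with `e * R * e = F e`. By primeness `R`
acts faithfully on `R * e`, by operators of finite rank, and densely: any linear map from a
finite-dimensional subspace to `R * e` is a left multiplication. Hence `R` is von Neumann regular,
and `f * R * f` is the full endomorphism algebra of the finite-dimensional space `f * R * e` for
every idempotent `f ≠ 0`.

If `f` has degree 1, the corner `f * R * f` is graded, so it remains to find enough such `f`. For
homogeneous `x`, regularity gives a homogeneous `w` of inverse degree with `x * w * x = x`; then `x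
* w` and `w * x` are idempotents of degree 1 fixing `x` from the left and from the right. Joining
such idempotents encloses any element in a corner (`IsGrading.exists_idempotent_corner`). -/

namespace GradedSimple

/-! ### Primeness of simple rings -/

section Simple

variable {R : Type*} [NonUnitalRing R] [IsSimpleRing R]

/-- In a simple ring, a property that cuts out a nonzero two-sided ideal holds everywhere. -/
theorem forall_of_isSimpleRing (p : R → Prop) (zero : p 0) (add : ∀ x y, p x → p y → p (x + y))
    (neg : ∀ x, p x → p (-x)) (left : ∀ r x, p x → p (r * x)) (right : ∀ r x, p x → p (x * r))
    {a : R} (ha : p a) (ha0 : a ≠ 0) (x : R) : p x := by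
  let I : TwoSidedIdeal R := TwoSidedIdeal.mk' {x | p x} zero (fun hx hy => add _ _ hx hy)
    (fun hx => neg _ hx) (fun hx => left _ _ hx) (fun hx => right _ _ hx)
  have hI : ∀ y, y ∈ I ↔ p y := fun y => TwoSidedIdeal.mem_mk' _ _ _ _ _ _ y
  rcases eq_bot_or_eq_top I with h | h
  · have : a ∈ I := (hI a).2 ha
    rw [h, TwoSidedIdeal.mem_bot] at this
    exact absurd this ha0
  · exact (hI x).1 (h ▸ trivial)

theorem eq_zero_of_forall_mul_left_eq_zero (h : ∃ a b : R, a * b ≠ 0) {u : R}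
    (hu : ∀ x, x * u = 0) : u = 0 := by
  by_contra h0
  obtain ⟨a, b, hab⟩ := h
  refine hab (forall_of_isSimpleRing (fun u : R => ∀ x, x * u = 0) (by simp) ?_ ?_ ?_ ?_ hu h0 b a)
  · intro x y hx hy z; rw [mul_add, hx, hy, add_zero]
  · intro x hx z; rw [mul_neg, hx, neg_zero]
  · intro r x hx z; rw [← mul_assoc, hx]
  · intro r x hx z; rw [← mul_assoc, hx, zero_mul]

theorem eq_zero_of_forall_mul_right_eq_zero (h : ∃ a b : R, a * b ≠ 0) {u : R}
    (hu : ∀ x, u * x = 0) : u = 0 := by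
  by_contra h0
  obtain ⟨a, b, hab⟩ := h
  refine hab (forall_of_isSimpleRing (fun u : R => ∀ x, u * x = 0) (by simp) ?_ ?_ ?_ ?_ hu h0 a b)
  · intro x y hx hy z; rw [add_mul, hx, hy, add_zero]
  · intro x hx z; rw [neg_mul, hx, neg_zero]
  · intro r x hx z; rw [mul_assoc, hx, mul_zero]
  · intro r x hx z; rw [mul_assoc, hx]

/-- A simple ring is prime, if its multiplication is not zero. -/
theorem eq_zero_or_eq_zero_of_forall_mul_mul (h : ∃ a b : R, a * b ≠ 0) {u v : R}
    (huv : ∀ r, u * r * v = 0) : u = 0 ∨ v = 0 := by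
  by_contra! h0
  have hu : ∀ y r, u * r * y = 0 := by
    refine forall_of_isSimpleRing (fun y : R => ∀ r, u * r * y = 0) (by simp) ?_ ?_ ?_ ?_ huv h0.2
    · intro x y hx hy z; rw [mul_add, hx, hy, add_zero]
    · intro x hx z; rw [mul_neg, hx, neg_zero]
    · intro r x hx z; rw [← mul_assoc, mul_assoc u, hx]
    · intro r x hx z; rw [← mul_assoc, hx, zero_mul]
  exact h0.1 <| eq_zero_of_forall_mul_right_eq_zero h fun x =>
    eq_zero_of_forall_mul_right_eq_zero h fun y => hu y x

/-- A simple algebra over a field of characteristic zero has nonzero multiplication. -/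
theorem exists_mul_ne_zero (F : Type*) [Field F] [CharZero F] [Module F R] :
    ∃ a b : R, a * b ≠ 0 := by
  by_contra! h
  obtain ⟨x, hx⟩ : ∃ x : R, x ≠ 0 := by
    by_contra! h0
    refine (bot_ne_top : (⊥ : TwoSidedIdeal R) ≠ ⊤) (TwoSidedIdeal.ext fun x => ?_)
    rw [h0 x]
    exact iff_of_true (zero_mem _) (zero_mem _)
  -- With zero multiplication every additive subgroup is an ideal, so `R` would be cyclic, which
  -- divisibility by 2 forbids.
  have key : ∀ y : R, y ∈ AddSubgroup.zmultiples x :=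
    forall_of_isSimpleRing (fun y : R => y ∈ AddSubgroup.zmultiples x) (zero_mem _)
      (fun _ _ => add_mem) (fun _ => neg_mem) (fun r y _ => by rw [h]; exact zero_mem _)
      (fun r y _ => by rw [h]; exact zero_mem _) (AddSubgroup.mem_zmultiples x) hx
  obtain ⟨n, hn⟩ := AddSubgroup.mem_zmultiples_iff.1 (key ((2⁻¹ : F) • x))
  rw [← Int.cast_smul_eq_zsmul F] at hn
  have h2 := smul_left_injective F hx hn
  have h3 : (n : F) * 2 = 1 := by rw [h2]; norm_num
  have h4 : n * 2 = 1 := by exact_mod_cast h3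
  omega

end Simple

/-! ### A primitive idempotent from a minimal one-sided ideal -/

section MinimalIdempotent

variable {F R : Type*} [Field F] [CharZero F] [NonUnitalRing R] [Module F R]
  [IsSimpleRing R]

/-- Brauer's lemma: since `L * L ≠ 0`, right multiplication by some `a ∈ L` is bijective on `L`, and
the solution of `e * a = a` in `L` is idempotent. -/
theorem exists_idempotent_of_isMinimalLeftIdeal [IsScalarTower F R R] {L : Submodule F R} (hL : IsMinimalLeftIdeal L)
    (hend : LeftEndIsScalar L) :
    ∃ e : R, e ≠ 0 ∧ e * e = e ∧ ∀ r, ∃ c : F, e * r * e = c • e := by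
  obtain ⟨⟨hL0, hLl⟩, hmin⟩ := hL
  have hne := exists_mul_ne_zero (R := R) F
  have hmin' : ∀ J : Submodule F R, J ≤ L → IsLeftIdeal J → J = ⊥ ∨ L ≤ J := by
    intro J hJ hJl
    by_cases h : J = ⊥
    · exact Or.inl h
    · exact Or.inr (hmin ⟨h, hJl⟩ hJ)
  obtain ⟨x, hxL, hx0⟩ := Submodule.exists_mem_ne_zero_of_ne_bot hL0
  obtain ⟨a, haL, y, hyL, hya⟩ : ∃ a ∈ L, ∃ y ∈ L, y * a ≠ 0 := by
    by_contra! h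
    rcases eq_zero_or_eq_zero_of_forall_mul_mul hne (u := x) (v := x)
      (fun r => by rw [mul_assoc]; exact h _ (hLl _ _ hxL) _ hxL) with h | h <;> exact hx0 h
  have hLa : L ≤ L.map (LinearMap.mulRight F a) := by
    refine (hmin' _ ?_ ?_).resolve_left ?_
    · rintro _ ⟨z, hz, rfl⟩
      exact hLl _ _ haL
    · rintro r _ ⟨z, hz, rfl⟩
      exact ⟨r * z, hLl _ _ hz, by simp [mul_assoc]⟩
    · exact fun h => hya ((Submodule.eq_bot_iff _).1 h _ ⟨y, hyL, rfl⟩)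
  obtain ⟨e, heL, hea⟩ := hLa haL
  replace hea : e * a = a := hea
  have ha0 : a ≠ 0 := by rintro rfl; simp at hya
  have hker : L ⊓ LinearMap.ker (LinearMap.mulRight F a) = ⊥ := by
    refine (hmin' _ inf_le_left ?_).resolve_right ?_
    · rintro r z ⟨hz, hza⟩
      refine ⟨hLl _ _ hz, ?_⟩
      have : z * a = 0 := hza
      simp [mul_assoc, this]
    · intro h
      exact hya (h hyL).2
  have hinj : ∀ z ∈ L, z * a = 0 → z = 0 := fun z hz hza =>
    (Submodule.eq_bot_iff _).1 hker z ⟨hz, hza⟩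
  have hee : e * e = e := by
    refine sub_eq_zero.1 (hinj _ (L.sub_mem (hLl _ _ heL) heL) ?_)
    rw [sub_mul, mul_assoc, hea, hea, sub_self]
  have he0 : e ≠ 0 := by rintro rfl; exact ha0 (by rw [← hea, zero_mul])
  refine ⟨e, he0, hee, fun r => ?_⟩
  have hre : r * e ∈ L := hLl _ _ heL
  -- Right multiplication by `e * r * e` is an endomorphism of `L`, hence a scalar, which is read
  -- off at `e`.
  obtain ⟨c, hc⟩ := hend ((LinearMap.mulRight F (e * (r * e))).restrict
    (fun z _ => hLl _ _ (hLl _ _ hre))) (by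
      rintro s ⟨z, hz⟩ ⟨w, hw⟩ h
      simp only at h
      simp [h, mul_assoc])
  refine ⟨c, ?_⟩
  have := congrArg Subtype.val (hc ⟨e, heL⟩)
  simpa [← mul_assoc, hee] using this

/-- The conclusion is left-right symmetric, so the left case in `Rᵐᵒᵖ` suffices. -/
theorem exists_idempotent_of_isMinimalRightIdeal [SMulCommClass F R R] {L : Submodule F R} (hL : IsMinimalRightIdeal L)
    (hend : RightEndIsScalar L) :
    ∃ e : R, e ≠ 0 ∧ e * e = e ∧ ∀ r, ∃ c : F, e * r * e = c • e := by
  let op : R ≃ₗ[F] Rᵐᵒᵖ := MulOpposite.opLinearEquiv F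
  have hideal : ∀ J : Submodule F Rᵐᵒᵖ, IsLeftIdeal J ↔ IsRightIdeal (J.comap op.toLinearMap) :=
    fun J => ⟨fun h r x hx => h (MulOpposite.op r) _ hx,
      fun h r x hx => h r.unop x.unop hx⟩
  have hbot : ∀ J : Submodule F Rᵐᵒᵖ, J = ⊥ ↔ J.comap op.toLinearMap = ⊥ := by
    intro J
    rw [Submodule.eq_bot_iff, Submodule.eq_bot_iff]
    exact ⟨fun h x hx => MulOpposite.op_injective (h _ hx),
      fun h x hx => MulOpposite.unop_injective (h x.unop hx)⟩
  have hmin : IsMinimalLeftIdeal (L.comap op.symm.toLinearMap) :=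
    ⟨⟨fun h => hL.1.1 ((hbot _).1 h), (hideal _).2 hL.1.2⟩, fun J hJ hJL x hx =>
      hL.2 ⟨fun h => hJ.1 ((hbot J).2 h), (hideal J).1 hJ.2⟩ (fun y hy => hJL hy) hx⟩
  have hend' : LeftEndIsScalar (L.comap op.symm.toLinearMap) := by
    intro f hf
    let i : L →ₗ[F] L.comap op.symm.toLinearMap := op.toLinearMap.restrict (fun x hx => hx)
    let j : L.comap op.symm.toLinearMap →ₗ[F] L := op.symm.toLinearMap.restrict (fun x hx => hx)
    obtain ⟨c, hc⟩ := hend (j ∘ₗ f ∘ₗ i) (fun r x y h =>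
      congrArg MulOpposite.unop (hf (MulOpposite.op r) (i x) (i y) (congrArg MulOpposite.op h)))
    exact ⟨c, fun x => Subtype.ext (congrArg (fun z : L => MulOpposite.op (z : R)) (hc (j x)))⟩
  obtain ⟨e, he0, hee, he⟩ := exists_idempotent_of_isMinimalLeftIdeal hmin hend'
  refine ⟨e.unop, fun h => he0 (MulOpposite.unop_injective h), congrArg MulOpposite.unop hee,
    fun r => ?_⟩
  obtain ⟨c, hc⟩ := he (MulOpposite.op r)
  exact ⟨c, by simpa [mul_assoc] using congrArg MulOpposite.unop hc⟩

end MinimalIdempotent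

/-! ### Finite rank, density and regularity -/

section FiniteRank

variable {F R : Type*} [Field F] [NonUnitalRing R] [Module F R]
  [IsScalarTower F R R] [SMulCommClass F R R]

variable (F) in
/-- Left multiplication by `x` as a map into the left ideal `R * e`. -/
def mulLeftOn (e x : R) : R →ₗ[F] R :=
  LinearMap.mulLeft F x ∘ₗ LinearMap.mulRight F e

@[simp]
theorem mulLeftOn_apply (e x r : R) : mulLeftOn F e x r = x * (r * e) := rfl

variable [IsSimpleRing R] {e : R} (he0 : e ≠ 0) (hee : e * e = e)
  (he : ∀ r, ∃ c : F, e * r * e = c • e)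

include he0 he in
-- The `x` with `x * R * e` finite-dimensional form a two-sided ideal containing `e`, because `e * R
-- * e = F e`.
theorem finiteDimensional_range_mulLeftOn (x : R) :
    FiniteDimensional F (LinearMap.range (mulLeftOn F e x)) := by
  have mono : ∀ {U W : Submodule F R}, FiniteDimensional F W → U ≤ W → FiniteDimensional F U :=
    fun _ h => Submodule.finiteDimensional_of_le h
  refine forall_of_isSimpleRing
    (fun x : R => FiniteDimensional F (LinearMap.range (mulLeftOn F e x))) ?_ ?_ ?_ ?_ ?_ ?_ he0 x
  · refine mono (W := ⊥) inferInstance ?_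
    rintro _ ⟨r, rfl⟩
    simp
  · intro x y hx hy
    refine mono (W := LinearMap.range (mulLeftOn F e x) ⊔ LinearMap.range (mulLeftOn F e y))
      inferInstance ?_
    rintro _ ⟨r, rfl⟩
    rw [mulLeftOn_apply, add_mul]
    exact Submodule.add_mem_sup ⟨r, rfl⟩ ⟨r, rfl⟩
  · intro x hx
    refine mono hx ?_
    rintro _ ⟨r, rfl⟩
    exact ⟨-r, by simp⟩
  · intro s x hx
    refine mono (W := (LinearMap.range (mulLeftOn F e x)).map (LinearMap.mulLeft F s))
      inferInstance ?_
    rintro _ ⟨r, rfl⟩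
    exact ⟨_, ⟨r, rfl⟩, by simp [mul_assoc]⟩
  · intro s x hx
    refine mono hx ?_
    rintro _ ⟨r, rfl⟩
    exact ⟨s * r, by simp [mul_assoc]⟩
  · refine mono (W := F ∙ e) inferInstance ?_
    rintro _ ⟨r, rfl⟩
    obtain ⟨c, hc⟩ := he r
    rw [mulLeftOn_apply, ← mul_assoc, hc]
    exact Submodule.smul_mem _ _ (Submodule.mem_span_singleton_self e)

include he0 hee he in
/-- Every linear functional on a finite-dimensional subspace of `R * e` is given by a left
multiplication followed by `e * · `. -/
theorem exists_mul_eq_functional (W : Submodule F R) [FiniteDimensional F W]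
    (hW : ∀ w ∈ W, w * e = w) (φ : Module.Dual F W) :
    ∃ b : R, ∀ w : W, e * b * (w : R) = φ w • e := by
  choose l hl using he
  have hinj := smul_left_injective F he0
  have hl' : ∀ (b : R) (w : W), e * (b * w) = l (b * w) • e := by
    intro b w
    rw [← hl, mul_assoc, mul_assoc, hW w w.2]
  let B : R →ₗ[F] W →ₗ[F] F := LinearMap.mk₂ F (fun b w => l (b * w))
    (fun b b' w => hinj (by
      simp only [add_smul, ← hl']; rw [add_mul, mul_add]))
    (fun c b w => hinj (by
      simp only [smul_eq_mul, mul_smul, ← hl']; rw [smul_mul_assoc, mul_smul_comm]))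
    (fun b w w' => hinj (by
      simp only [add_smul, ← hl']; rw [Submodule.coe_add, mul_add, mul_add]))
    (fun c b w => hinj (by
      simp only [smul_eq_mul, mul_smul, ← hl']
      rw [Submodule.coe_smul, mul_smul_comm, mul_smul_comm]))
  -- By primeness `e * R * w = 0` forces `w = 0`. As `W` is finite-dimensional, this makes `R → W*`
  -- surjective.
  have hB : Function.Injective B.flip := by
    refine (injective_iff_map_eq_zero _).2 fun w hw => Subtype.ext ?_
    refine (eq_zero_or_eq_zero_of_forall_mul_mul ⟨e, e, hee.symm ▸ he0⟩ fun b => ?_).resolve_left he0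
    have : l (b * w) = 0 := LinearMap.congr_fun hw b
    rw [mul_assoc, hl', this, zero_smul]
  obtain ⟨b, hb⟩ := LinearMap.flip_injective_iff₂.1 hB φ
  refine ⟨b, fun w => ?_⟩
  rw [mul_assoc, hl', ← hb]
  rfl

include he0 hee he in
/-- Density: a linear map from a finite-dimensional subspace of `R * e` to `R * e` is a left
multiplication. -/
theorem exists_mul_eq_linearMap (W : Submodule F R) [FiniteDimensional F W]
    (hW : ∀ w ∈ W, w * e = w) (T : W →ₗ[F] R) (hT : ∀ w, T w * e = T w) :
    ∃ y : R, ∀ w : W, y * (w : R) = T w := by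
  let b := Module.finBasis F W
  choose β hβ using fun i => exists_mul_eq_functional he0 hee he W hW (b.coord i)
  -- Each summand acts on `W` as the rank-one operator `w ↦ (b.coord i w) • T (b i)`.
  let y : R := ∑ i, T (b i) * (e * β i)
  have hy : ∀ w : W, y * (w : R) = T w := by
    intro w
    calc y * (w : R) = ∑ i, T (b i) * (e * β i * w) := by
          rw [Finset.sum_mul]; simp only [mul_assoc]
      _ = ∑ i, b.repr w i • T (b i) := by
          refine Finset.sum_congr rfl fun i _ => ?_
          rw [hβ, mul_smul_comm, hT, Module.Basis.coord_apply]
      _ = T (∑ i, b.repr w i • b i) := by rw [map_sum]; simp only [map_smul]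
      _ = T w := by rw [b.sum_repr]
  exact ⟨y, hy⟩

include he0 hee in
theorem eq_of_forall_mul_mul_eq {a b : R} (h : ∀ r, a * (r * e) = b * (r * e)) : a = b := by
  refine sub_eq_zero.1 ((eq_zero_or_eq_zero_of_forall_mul_mul ⟨e, e, hee.symm ▸ he0⟩
    (v := e) fun r => ?_).resolve_right he0)
  rw [mul_assoc, sub_mul, h, sub_self]

include he0 hee he in
/-- The ring is von Neumann regular. -/
theorem exists_mul_mul_eq_self (x : R) : ∃ y : R, x * y * x = x := by
  have := finiteDimensional_range_mulLeftOn he0 he x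
  obtain ⟨s, hs⟩ := (mulLeftOn F e x).rangeRestrict.exists_rightInverse_of_surjective
    (LinearMap.range_rangeRestrict _)
  have hs' : ∀ w, x * (s w * e) = w := fun w =>
    congrArg Subtype.val (LinearMap.congr_fun hs w)
  -- Here `y` realizes a linear section of `x` on `x * R * e`, so `x * y * x` and `x` agree on `R *
  -- e`.
  obtain ⟨y, hy⟩ := exists_mul_eq_linearMap he0 hee he (LinearMap.range (mulLeftOn F e x))
    (by rintro _ ⟨r, rfl⟩; simp [mul_assoc, hee]) (LinearMap.mulRight F e ∘ₗ s)
    (by intro w; simp [mul_assoc, hee])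
  refine ⟨y, eq_of_forall_mul_mul_eq he0 hee fun r => ?_⟩
  have := hy ⟨_, r, rfl⟩
  simp only [mulLeftOn_apply, LinearMap.comp_apply, LinearMap.mulRight_apply] at this
  rw [mul_assoc, mul_assoc, this]
  exact hs' _

end FiniteRank

/-! ### Corners as matrix algebras -/

section Corner

variable {F R : Type*} [Field F] [NonUnitalRing R] [Module F R]
  [IsScalarTower F R R] [SMulCommClass F R R]

variable (F) in
/-- The elements of `R` on which `f` acts as an identity; it is `f * R * f` for idempotent `f`. -/
def corner (f : R) : NonUnitalSubalgebra F R where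
  carrier := {x | f * x = x ∧ x * f = x}
  zero_mem' := by simp
  add_mem' := by
    rintro a b ⟨h1, h2⟩ ⟨h3, h4⟩
    exact ⟨by rw [mul_add, h1, h3], by rw [add_mul, h2, h4]⟩
  mul_mem' := by
    rintro a b ⟨h1, h2⟩ ⟨h3, h4⟩
    exact ⟨by rw [← mul_assoc, h1], by rw [mul_assoc, h4]⟩
  smul_mem' := by
    rintro c a ⟨h1, h2⟩
    exact ⟨by rw [mul_smul_comm, h1], by rw [smul_mul_assoc, h2]⟩

theorem mem_corner {f x : R} : x ∈ corner F f ↔ f * x = x ∧ x * f = x := Iff.rfl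

theorem corner_le_corner {f h : R} (hf : f ∈ corner F h) : corner F f ≤ corner F h := by
  rintro x ⟨h1, h2⟩
  rw [mem_corner] at hf ⊢
  exact ⟨by rw [← h1, ← mul_assoc, hf.1], by rw [← h2, mul_assoc, hf.2]⟩

/-- The corner acts on `f * R * e`: faithfully, since `a = a * f` and `R * e` is faithful, and
fully, by density after replacing `y` by `f * y * f`. -/
theorem isMatrixSubalgebra_corner [IsSimpleRing R] {e : R} (he0 : e ≠ 0) (hee : e * e = e)
    (he : ∀ r, ∃ c : F, e * r * e = c • e) {f : R} (hf0 : f ≠ 0) (hff : f * f = f) :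
    IsMatrixSubalgebra (corner F f) := by
  have := finiteDimensional_range_mulLeftOn he0 he f
  set W := LinearMap.range (mulLeftOn F e f) with hWdef
  have hWe : ∀ w ∈ W, w * e = w := by rintro _ ⟨r, rfl⟩; simp [mul_assoc, hee]
  have hWf : ∀ w ∈ W, f * w = w := by rintro _ ⟨r, rfl⟩; simp [← mul_assoc, hff]
  have hmaps : ∀ a ∈ corner F f, ∀ w ∈ W, LinearMap.mulLeft F a w ∈ W := by
    rintro a ⟨ha, -⟩ w hw
    refine ⟨a * w, ?_⟩
    rw [mulLeftOn_apply, mul_assoc, hWe w hw, ← mul_assoc, ha]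
    rfl
  let ψ : corner F f →ₙₐ[F] Module.End F W :=
    { toFun := fun a => (LinearMap.mulLeft F (a : R)).restrict (hmaps a a.2)
      map_smul' := fun c a => by ext w; simp [smul_mul_assoc]
      map_zero' := by ext w; simp
      map_add' := fun a b => by ext w; simp [add_mul]
      map_mul' := fun a b => by ext w; simp }
  have hψ : ∀ (a : corner F f) (w : W), (ψ a w : R) = a * w := fun a w => rfl
  have hinj : Function.Injective ψ := by
    intro a b hab
    refine Subtype.ext (eq_of_forall_mul_mul_eq he0 hee fun r => ?_)
    have := congrArg Subtype.val (LinearMap.congr_fun hab ⟨_, r, rfl⟩)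
    rw [hψ, hψ] at this
    simp only [mulLeftOn_apply] at this
    rwa [← mul_assoc, ← mul_assoc (b : R), a.2.2, b.2.2] at this
  have hsurj : Function.Surjective ψ := by
    intro T
    obtain ⟨y, hy⟩ := exists_mul_eq_linearMap he0 hee he W hWe (W.subtype ∘ₗ T)
      (fun w => hWe _ (T w).2)
    refine ⟨⟨f * y * f, mem_corner.2 ⟨?_, ?_⟩⟩, ?_⟩
    · rw [← mul_assoc, ← mul_assoc, hff]
    · rw [mul_assoc, hff]
    · ext w
      rw [hψ, mul_assoc, hWf w w.2, mul_assoc, hy w]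
      exact hWf _ (T w).2
  have hWne : Nontrivial W := by
    rw [Submodule.nontrivial_iff_ne_bot]
    intro h
    refine hf0 (eq_of_forall_mul_mul_eq he0 hee fun r => ?_)
    rw [zero_mul]
    exact (Submodule.eq_bot_iff _).1 h _ ⟨r, rfl⟩
  let m := algEquivMatrix (Module.finBasis F W)
  refine ⟨Module.finrank F W, Module.finrank_pos,
    (m : Module.End F W →ₙₐ[F] Matrix _ _ F).comp ψ, ?_⟩
  exact m.bijective.comp ⟨hinj, hsurj⟩

end Corner

/-! ### Idempotents of degree one -/

section Graded

variable {F R G : Type*} [Field F] [NonUnitalRing R] [Module F R] [Group G] [DecidableEq G]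
  {𝓡 : G → Submodule F R} (h𝓡 : IsGrading 𝓡)

include h𝓡

theorem IsGrading.induction {p : R → Prop} (zero : p 0) (mem : ∀ g, ∀ x ∈ 𝓡 g, p x)
    (add : ∀ x y, p x → p y → p (x + y)) (x : R) : p x :=
  Submodule.iSup_induction 𝓡 (motive := p) (h𝓡.isInternal.submodule_iSup_eq_top.symm ▸ Submodule.mem_top)
    mem zero add

/-- A quasi-inverse of a homogeneous element can be chosen homogeneous of inverse degree. -/
theorem IsGrading.exists_mem_mul_mul_eq_self {g : G} {x y : R} (hx : x ∈ 𝓡 g)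
    (hxy : x * y * x = x) : ∃ w ∈ 𝓡 g⁻¹, x * w * x = x := by
  have := h𝓡.isInternal.chooseDecomposition
  refine ⟨DirectSum.decompose 𝓡 y g⁻¹, SetLike.coe_mem _, ?_⟩
  -- The map `z ↦ x * z * x` sends degree `k` to `g * k * g`, which equals `g` only for `k = g⁻¹`.
  have key : ∀ z : R, x * (DirectSum.decompose 𝓡 z g⁻¹ : R) * x =
      DirectSum.decompose 𝓡 (x * z * x) g := by
    refine h𝓡.induction (by simp) (fun k z hz => ?_) (fun a b ha hb => ?_)
    · have hm : x * z * x ∈ 𝓡 (g * k * g) := h𝓡.mul_mem _ _ _ (h𝓡.mul_mem _ _ _ hx _ hz) _ hx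
      by_cases hk : k = g⁻¹
      · subst hk
        rw [DirectSum.decompose_of_mem_same 𝓡 hz]
        rw [mul_inv_cancel, one_mul] at hm
        rw [DirectSum.decompose_of_mem_same 𝓡 hm]
      · rw [DirectSum.decompose_of_mem_ne 𝓡 hz hk, DirectSum.decompose_of_mem_ne 𝓡 hm]
        · simp
        · intro h
          exact hk (eq_inv_of_mul_eq_one_right (by simpa using h))
    · simp only [DirectSum.decompose_add, DirectSum.add_apply, Submodule.coe_add, mul_add, add_mul,
        ha, hb]
  rw [key, hxy, DirectSum.decompose_of_mem_same 𝓡 hx]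

variable [IsScalarTower F R R] [SMulCommClass F R R]

/-- The part `z` of `x` missed by `e` is fixed by the idempotent `u = z * w`. Only `e * u = 0` is
guaranteed, so the correction `- u * e` is what makes the join `e + u - u * e` idempotent. -/
theorem IsGrading.exists_idempotent_mul_left (hreg : ∀ x : R, ∃ y, x * y * x = x) {e : R}
    (he1 : e ∈ 𝓡 1) (hee : e * e = e) {g : G} {x : R} (hx : x ∈ 𝓡 g) :
    ∃ h ∈ 𝓡 1, h * h = h ∧ e ∈ corner F h ∧ h * x = x := by
  set z := x - e * x with hz
  have hzg : z ∈ 𝓡 g := sub_mem hx (by simpa using h𝓡.mul_mem 1 g e he1 x hx)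
  obtain ⟨y, hy⟩ := hreg z
  obtain ⟨w, hw, hzw⟩ := h𝓡.exists_mem_mul_mul_eq_self hzg hy
  obtain ⟨u, hu⟩ : ∃ u, u = z * w := ⟨_, rfl⟩
  rw [← hu] at hzw
  have hez : e * z = 0 := by rw [hz, mul_sub, ← mul_assoc, hee, sub_self]
  have heu : e * u = 0 := by rw [hu, ← mul_assoc, hez, zero_mul]
  have huu : u * u = u := by
    calc u * u = u * z * w := by rw [mul_assoc, ← hu]
      _ = u := by rw [hzw, hu]
  have hu1 : u ∈ 𝓡 1 := by simpa [hu] using h𝓡.mul_mem g g⁻¹ z hzg w hw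
  have hue : u * e ∈ 𝓡 1 := by simpa using h𝓡.mul_mem 1 1 u hu1 e he1
  have h1 : e * (e + u - u * e) = e := by
    rw [mul_sub, mul_add, hee, ← mul_assoc, heu, zero_mul, add_zero, sub_zero]
  have h2 : (e + u - u * e) * e = e := by
    rw [sub_mul, add_mul, hee, mul_assoc, hee, add_sub_cancel_right]
  have h3 : u * (e + u - u * e) = u := by
    rw [mul_sub, mul_add, huu, ← mul_assoc, huu, add_sub_cancel_left]
  refine ⟨e + u - u * e, sub_mem (add_mem he1 hu1) hue, ?_, ⟨h2, h1⟩, ?_⟩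
  · rw [sub_mul, add_mul, h1, h3, mul_assoc, h1]
  · have h4 : (e + u - u * e) * z = z := by
      rw [sub_mul, add_mul, hez, mul_assoc u, hez, mul_zero, sub_zero, zero_add, hzw]
    have h5 : x = z + e * x := by rw [hz, sub_add_cancel]
    rw [h5, mul_add, h4, ← mul_assoc, h2]

/-- Mirror image, with `u = w * z`, `u * e = 0` and the join `e + u - e * u`. -/
theorem IsGrading.exists_idempotent_mul_right (hreg : ∀ x : R, ∃ y, x * y * x = x) {e : R}
    (he1 : e ∈ 𝓡 1) (hee : e * e = e) {g : G} {x : R} (hx : x ∈ 𝓡 g) :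
    ∃ h ∈ 𝓡 1, h * h = h ∧ e ∈ corner F h ∧ x * h = x := by
  set z := x - x * e with hz
  have hzg : z ∈ 𝓡 g := sub_mem hx (by simpa using h𝓡.mul_mem g 1 x hx e he1)
  obtain ⟨y, hy⟩ := hreg z
  obtain ⟨w, hw, hzw⟩ := h𝓡.exists_mem_mul_mul_eq_self hzg hy
  obtain ⟨u, hu⟩ : ∃ u, u = w * z := ⟨_, rfl⟩
  rw [mul_assoc, ← hu] at hzw
  have hze : z * e = 0 := by rw [hz, sub_mul, mul_assoc, hee, sub_self]
  have hue : u * e = 0 := by rw [hu, mul_assoc, hze, mul_zero]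
  have huu : u * u = u := by
    calc u * u = w * (z * u) := by rw [← mul_assoc, ← hu]
      _ = u := by rw [hzw, hu]
  have hu1 : u ∈ 𝓡 1 := by simpa [hu] using h𝓡.mul_mem g⁻¹ g w hw z hzg
  have heu : e * u ∈ 𝓡 1 := by simpa using h𝓡.mul_mem 1 1 e he1 u hu1
  have h1 : (e + u - e * u) * e = e := by
    rw [sub_mul, add_mul, hee, mul_assoc, hue, mul_zero, add_zero, sub_zero]
  have h2 : e * (e + u - e * u) = e := by
    rw [mul_sub, mul_add, hee, ← mul_assoc, hee, add_sub_cancel_right]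
  have h3 : (e + u - e * u) * u = u := by
    rw [sub_mul, add_mul, huu, mul_assoc, huu, add_sub_cancel_left]
  refine ⟨e + u - e * u, sub_mem (add_mem he1 hu1) heu, ?_, ⟨h1, h2⟩, ?_⟩
  · rw [mul_sub, mul_add, h1, h3, ← mul_assoc, h1]
  · have h4 : z * (e + u - e * u) = z := by
      rw [mul_sub, mul_add, hze, ← mul_assoc z e u, hze, zero_mul, sub_zero, zero_add, hzw]
    have h5 : x = z + x * e := by rw [hz, sub_add_cancel]
    rw [h5, add_mul, h4, mul_assoc, h2]

/-- In a graded regular algebra, the idempotents of degree one are cofinal: any such idempotent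
and any element lie in a common corner given by such an idempotent. -/
theorem IsGrading.exists_idempotent_corner (hreg : ∀ x : R, ∃ y, x * y * x = x) (x : R) :
    ∀ e ∈ 𝓡 1, e * e = e → ∃ h ∈ 𝓡 1, h * h = h ∧ e ∈ corner F h ∧ x ∈ corner F h := by
  refine h𝓡.induction (p := fun x => ∀ e ∈ 𝓡 1, e * e = e →
    ∃ h ∈ 𝓡 1, h * h = h ∧ e ∈ corner F h ∧ x ∈ corner F h) ?_ ?_ ?_ x
  · exact fun e he1 hee => ⟨e, he1, hee, ⟨hee, hee⟩, zero_mem _⟩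
  · intro g x hx e he1 hee
    obtain ⟨h, hh1, hhh, heh, hhx⟩ := h𝓡.exists_idempotent_mul_left hreg he1 hee hx
    obtain ⟨k, hk1, hkk, hhk, hxk⟩ := h𝓡.exists_idempotent_mul_right hreg hh1 hhh hx
    exact ⟨k, hk1, hkk, corner_le_corner (F := F) hhk heh,
      by rw [← hhx, ← mul_assoc, hhk.1], hxk⟩
  · intro x y hx hy e he1 hee
    obtain ⟨h, hh1, hhh, heh, hxh⟩ := hx e he1 hee
    obtain ⟨k, hk1, hkk, hhk, hyk⟩ := hy h hh1 hhh
    have hle := corner_le_corner (F := F) hhk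
    exact ⟨k, hk1, hkk, hle heh, add_mem (hle hxh) hyk⟩

/-- The projection `x ↦ f * x * f` onto the corner preserves degrees. -/
theorem IsGrading.isGradedSubspace_corner {f : R} (hf1 : f ∈ 𝓡 1) (hff : f * f = f) :
    IsGradedSubspace 𝓡 (corner F f).toSubmodule := by
  refine le_antisymm ?_ (iSup_le fun g => inf_le_left)
  have key : ∀ x : R, f * x * f ∈ ⨆ g, (corner F f).toSubmodule ⊓ 𝓡 g := by
    refine h𝓡.induction (by simp) (fun g x hx => ?_) (fun x y hx hy => ?_)
    · refine Submodule.mem_iSup_of_mem g ⟨⟨?_, ?_⟩, ?_⟩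
      · rw [← mul_assoc, ← mul_assoc, hff]
      · rw [mul_assoc, hff]
      · simpa using h𝓡.mul_mem _ _ _ (h𝓡.mul_mem _ _ _ hf1 _ hx) _ hf1
    · rw [mul_add, add_mul]
      exact add_mem hx hy
  rintro x ⟨h1, h2⟩
  have := key x
  rwa [h1, h2] at this

end Graded

end GradedSimple

theorem theorem4 {F R G : Type*} [Field F] [IsAlgClosed F] [CharZero F]
    [NonUnitalRing R] [Module F R] [IsScalarTower F R R] [SMulCommClass F R R]
    [IsSimpleRing R] (hR : GradedSimple.HasMinimalOneSidedIdealOverGroundField F R)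
    [CommGroup G] [Finite G] [DecidableEq G]
    (𝓡 : G → Submodule F R) (h𝓡 : GradedSimple.IsGrading 𝓡) :
    ∃ 𝓢 : Set (NonUnitalSubalgebra F R), GradedSimple.IsLocalSystem 𝓢 ∧
      ∀ A ∈ 𝓢, GradedSimple.IsMatrixSubalgebra A ∧
        GradedSimple.IsGradedSubspace 𝓡 A.toSubmodule := by
  obtain ⟨e, he0, hee, he⟩ : ∃ e : R, e ≠ 0 ∧ e * e = e ∧ ∀ r, ∃ c : F, e * r * e = c • e := by
    rcases hR with ⟨L, hL, hend⟩ | ⟨L, hL, hend⟩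
    · exact GradedSimple.exists_idempotent_of_isMinimalLeftIdeal hL hend
    · exact GradedSimple.exists_idempotent_of_isMinimalRightIdeal hL hend
  have hreg := GradedSimple.exists_mul_mul_eq_self he0 hee he
  have hloc := h𝓡.exists_idempotent_corner hreg
  have hne : ∀ {f h : R}, f ≠ 0 → f ∈ GradedSimple.corner F h → h ≠ 0 := by
    rintro f h hf ⟨hfh, -⟩ rfl
    exact hf (by rw [← hfh, zero_mul])
  -- The idempotent 0 is excluded because its corner is zero, whereas matrix size `n ≥ 1` is
  -- required.
  refine ⟨{A | ∃ f ∈ 𝓡 1, f ≠ 0 ∧ f * f = f ∧ A = GradedSimple.corner F f}, ⟨?_, ?_⟩, ?_⟩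
  · rintro _ ⟨f, hf1, hf0, hff, rfl⟩ _ ⟨k, hk1, hk0, hkk, rfl⟩
    obtain ⟨h, hh1, hhh, hfh, hkh⟩ := hloc k f hf1 hff
    exact ⟨_, ⟨h, hh1, hne hf0 hfh, hhh, rfl⟩, GradedSimple.corner_le_corner hfh,
      GradedSimple.corner_le_corner hkh⟩
  · intro x
    -- Starting from the idempotent 0, `e` is enclosed before `x`, so that the final idempotent is
    -- nonzero even when `x = 0`.
    obtain ⟨k, hk1, hkk, -, hek⟩ := hloc e 0 (zero_mem _) (mul_zero 0)
    obtain ⟨h, hh1, hhh, hkh, hxh⟩ := hloc x k hk1 hkk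
    exact ⟨_, ⟨h, hh1, hne (hne he0 hek) hkh, hhh, rfl⟩, hxh⟩
  · rintro _ ⟨f, hf1, hf0, hff, rfl⟩
    exact ⟨GradedSimple.isMatrixSubalgebra_corner he0 hee he hf0 hff,
      h𝓡.isGradedSubspace_corner hf1 hff⟩
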